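/- Let $\mathcal A,\mathcal B$ be finite nonempty action sets of a learner and an opponent, let $U:\mathcal A\times\mathcal B\to[0,1]$ be the learner's utility, let $0\le m^*<M$ be integers, and let the opponent play a fixed strategy of memory $m^*$, $\psi:(\mathcal A\times\mathcal B)^{m^*}\to\Delta_{\mathcal B}$. For $m^*\le i\le M-1$ let $\mathcal M_i$ be the Markov decision process with state space $\mathcal S_i=(\mathcal A\times\mathcal B)^i$ (the last $i$ action pairs) and action set $\mathcal A$ in which, in state $s$ and under the learner's action $a$, the opponent's action $b$ is drawn from $\psi(\cdot\mid\text{last }m^*\text{ pairs of }s)$, the reward is $U(a,b)$, and the next state is obtained from $s$ by appending $(a,b)$ and forgetting the oldest pair. Policies in $\mathcal M_i$ are maps $\pi:\mathcal S_i\to\Delta_{\mathcal A}$. Define the gain $$g_i^\pi(s)=\lim_{T\to\infty}\tfrac1T\,\mathbf E^\pi_s\sum_{t=1}^T R_t$$ and the bias $$h_i^\pi(s)=\lim_{T\to\infty}\mathbf E_s^\pi\sum_{t=1}^T\bigl(R_t-g_i^\pi(S_t)\bigr),$$ the latter limit being a Cesàro limit (the limit of the averages of the partial sums), and for a vector $h$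 put $\mathsf{sp}(h)=\max h-\min h$. A policy of $\mathcal M_i$ is called optimal if it maximizes the gain from every state. The optimal bias $h_i^*$ is the bias of an optimal policy which dominates, in every state, the bias of every optimal policy. The Bellman optimality equation of $\mathcal M_i$ is $g+h=L_ih$, where $L_ih(s)=\max_{a}\{r_i(s,a)+\sum_{s'}P_i(s'\mid s,a)h(s')\}$ and $r_i(s,a)$ is the expected reward. Assume that $\mathcal M_{m^*}$ is weakly communicating: there is a closed set of states in which each state is accessible from every other one under some deterministic policy, while every state outside this set is transient under every policy. Then the limits defining $g_i^\pi(s)$ and $h_i^\pi(s)$ exist for all $m^*\le i\le M-1$, all policies $\pi$ of $\mathcal M_i$ and all $s\in\mathcal S_i$, and the following hold. 1. For every $i\in\{m^*,\dots,M-1\}$ the optimal gain $g_i^*=\sup_\pi g_i^\pi(s)$ does not depend on $s$, and $$g^*_{m^*}=g^*_{m^*+1}=\dots=g^*_{M-1}=:g^*.$$ 2. For every $i\in\{m^*,\dots,M-1\}$ the optimal bias $h_i^*$ exists and satisfies $g^*+h_i^*=L_ih_i^*$, and $$\mathsf{sp}(h^*_{m^*})=\mathsf{sp}(h^*_{m^*+1})=\dots=\mathsf{sp}(h^*_{M-1}).$$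 3. The set $\{\mathsf{sp}(h): g^*+h=L_ih\}$ of the spans of all solutions of the Bellman optimality equation is the same for all $i\in\{m^*,\dots,M-1\}$. 4. Every optimal policy $\pi$ of $\mathcal M_{m^*}$, regarded as a policy of $\mathcal M_i$ that uses only the last $m^*$ action pairs, is optimal in $\mathcal M_i$, and $\mathsf{sp}(h_i^{\pi})=\mathsf{sp}(h_{m^*}^{\pi})$, for all $i\in\{m^*,\dots,M-1\}$. -/

import Mathlib

open Filter Topology

noncomputable section

/-- A finite Markov decision process: transition probabilities `P s a s' = P(s' ∣ s, a)` and
(expected) one-step rewards `r s a`. -/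
structure FiniteMDP (S A : Type*) [Fintype S] where
  P : S → A → S → ℝ
  r : S → A → ℝ
  P_nonneg : ∀ s a s', 0 ≤ P s a s'
  P_sum : ∀ s a, ∑ s', P s a s' = 1

/-- The span `sp(h) = max h - min h` of a vector on a finite nonempty set. -/
def biasSpan {S : Type*} (h : S → ℝ) : ℝ := (⨆ s, h s) - ⨅ s, h s

namespace FiniteMDP

variable {S A : Type*} [Fintype S] [Fintype A]

/-- Memoryless randomized policies `S → Δ_A`. -/
abbrev Policy (S A : Type*) [Fintype A] := S → stdSimplex ℝ A

open Classical in
/-- The deterministic memoryless policy choosing `d s` in state `s`. -/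
def detPolicy (d : S → A) : Policy S A :=
  fun s => ⟨Pi.single (d s) 1, single_mem_stdSimplex ℝ (d s)⟩

/-- The transition matrix `P^π` of the Markov chain of states under `π`. -/
def chain (D : FiniteMDP S A) (π : Policy S A) : Matrix S S ℝ :=
  fun s s' => ∑ a, (π s).1 a * D.P s a s'

/-- The expected one-step reward `r^π` under `π`. -/
def polReward (D : FiniteMDP S A) (π : Policy S A) : S → ℝ :=
  fun s => ∑ a, (π s).1 a * D.r s a

open Classical in
/-- `stateProb π n s s'` is the probability, started from `s` and following `π`, of being
in `s'` after `n` transitions. -/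
def stateProb (D : FiniteMDP S A) (π : Policy S A) (n : ℕ) (s s' : S) : ℝ :=
  (D.chain π ^ n) s s'

/-- `E_s^π [f(S_{n+1})]`, where `S_1 = s`. -/
def expect (D : FiniteMDP S A) (π : Policy S A) (f : S → ℝ) (n : ℕ) (s : S) : ℝ :=
  ∑ s', D.stateProb π n s s' * f s'

/-- The value `V_T^π(s) = E_s^π ∑_{t=1}^T R_t`. -/
def value (D : FiniteMDP S A) (π : Policy S A) (T : ℕ) (s : S) : ℝ :=
  ∑ t ∈ Finset.range T, D.expect π (D.polReward π) t s

/-- The gain `g^π(s) = lim_T V_T^π(s) / T`. -/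
def gain (D : FiniteMDP S A) (π : Policy S A) (s : S) : ℝ :=
  limUnder atTop fun T : ℕ => D.value π T s / T

/-- The partial sums `E_s^π ∑_{t=1}^T (R_t - g^π(S_t))`. -/
def biasSum (D : FiniteMDP S A) (π : Policy S A) (T : ℕ) (s : S) : ℝ :=
  ∑ t ∈ Finset.range T, D.expect π (fun s' => D.polReward π s' - D.gain π s') t s

/-- The averages of the first `N` partial sums `E_s^π ∑_{t=1}^T (R_t - g^π(S_t))`. -/
def biasMean (D : FiniteMDP S A) (π : Policy S A) (N : ℕ) (s : S) : ℝ :=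
  (∑ T ∈ Finset.Icc 1 N, D.biasSum π T s) / N

/-- The bias `h^π(s) = lim_T E_s^π ∑_{t=1}^T (R_t - g^π(S_t))`, the limit being taken in the
Cesaro sense so that it also exists for periodic chains (it is the ordinary limit whenever
that exists). -/
def bias (D : FiniteMDP S A) (π : Policy S A) (s : S) : ℝ :=
  limUnder atTop fun N : ℕ => D.biasMean π N s

/-- `g` is the optimal gain: `g = g*(s) = sup_π g^π(s)` for every state `s`. -/
def IsOptimalGain (D : FiniteMDP S A) (g : ℝ) : Prop :=
  ∀ s, IsLUB (Set.range fun π : Policy S A => D.gain π s) g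

/-- `π` is an optimal policy: it maximizes the gain from every state. -/
def IsOptimalPolicy (D : FiniteMDP S A) (π : Policy S A) : Prop :=
  ∀ (π' : Policy S A) (s : S), D.gain π' s ≤ D.gain π s

/-- `h` is the optimal bias function: it is the bias of an optimal policy and dominates the
biases of all optimal policies in every state. -/
def IsOptimalBias (D : FiniteMDP S A) (h : S → ℝ) : Prop :=
  (∃ π, D.IsOptimalPolicy π ∧ D.bias π = h) ∧
    ∀ π, D.IsOptimalPolicy π → ∀ s, D.bias π s ≤ h s

/-- The Bellman operator `L h (s) = max_a { r(s,a) + ∑_{s'} P(s' ∣ s,a) h(s') }`. -/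
def bellman (D : FiniteMDP S A) (h : S → ℝ) (s : S) : ℝ :=
  ⨆ a, (D.r s a + ∑ s', D.P s a s' * h s')

/-- `g = L h - h`. -/
def SolvesBellman (D : FiniteMDP S A) (g : ℝ) (h : S → ℝ) : Prop :=
  ∀ s, D.bellman h s - h s = g

/-- `s` is transient under `π`: the expected number of visits to `s` from `s` is finite. -/
def IsTransient (D : FiniteMDP S A) (π : Policy S A) (s : S) : Prop :=
  Summable fun n : ℕ => D.stateProb π n s s

/-- There is a closed set of states each of which is accessible from every other one under some
deterministic policy, and all the other states are transient under every policy. -/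
def WeaklyCommunicating (D : FiniteMDP S A) : Prop :=
  ∃ C : Set S,
    (∀ s ∈ C, ∀ a, ∀ s' ∉ C, D.P s a s' = 0) ∧
    (∀ s ∈ C, ∀ s' ∈ C, ∃ (d : S → A) (n : ℕ), 0 < D.stateProb (detPolicy d) n s s') ∧
    (∀ s ∉ C, ∀ π : Policy S A, D.IsTransient π s)

end FiniteMDP

namespace RepeatedGame

variable {A B : Type*}

/-- The last `m` interactions (action pairs), index `0` being the most recent one. -/
abbrev History (A B : Type*) (m : ℕ) := Fin m → A × B

/-- Add the newest interaction and forget the oldest one. -/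
def push {m : ℕ} (o : A × B) (s : History A B m) : History A B m :=
  fun k => (Fin.cons o s : Fin (m + 1) → A × B) k.castSucc

/-- The `m` most recent interactions out of the last `i`. -/
def recent {m i : ℕ} (hmi : m ≤ i) (s : History A B i) : History A B m :=
  fun k => s (Fin.castLE hmi k)

variable [Fintype A] [Fintype B]

open Classical in
/-- The MDP with states `(A × B)^i` which an opponent strategy `ψ : (A × B)^m → Δ_B`, `m ≤ i`,
induces: in state `s`, when the learner plays `a`, the opponent plays `b` with probability
`ψ(b ∣ last m interactions)`, the reward is `U a b` and the next state is `push (a, b) s`. -/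
def inducedMDP {m i : ℕ} (hmi : m ≤ i) (U : A → B → ℝ) (ψ : History A B m → stdSimplex ℝ B) :
    FiniteMDP (History A B i) A where
  P s a s' := ∑ b, if s' = push (a, b) s then (ψ (recent hmi s)).1 b else 0
  r s a := ∑ b, (ψ (recent hmi s)).1 b * U a b
  P_nonneg s a s' := by
    refine Finset.sum_nonneg fun b _ => ?_
    split_ifs
    · exact (ψ (recent hmi s)).2.1 b
    · exact le_rfl
  P_sum s a := by
    rw [Finset.sum_comm]
    simpa using (ψ (recent hmi s)).2.2

/-- A policy of order `m`, regarded as a policy on the last `i ≥ m` interactions. -/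
def liftPolicy {m i : ℕ} (hmi : m ≤ i) (π : FiniteMDP.Policy (History A B m) A) :
    FiniteMDP.Policy (History A B i) A :=
  fun s => π (recent hmi s)

end RepeatedGame

end

open FiniteMDP RepeatedGame

/-! Keeping only the last `mstar` pairs maps each larger process onto the smallest one: rewards and
projected transitions depend on a state only through its image. Pulling functions back along
`recent` therefore commutes with the Bellman operators, and it preserves spans because `recent` is
surjective. Conversely, every Bellman solution is such a pullback (`eq_of_solvesBellman`): the
right-hand side of `h = L h - g` cannot see the oldest unneeded pair, so dependence on the pairs
beyond `mstar` disappears one pair at a time.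

Policies with longer memory are not pullbacks, so optimality is transferred by a certificate `(g, h,
w)`, a solution of `SolvesNestedBellman`. Any such triple forces `g` to be the optimal gain and `h`
the optimal bias, and it pulls back.

Only in the smallest process must a certificate be found
(`WeaklyCommunicating.exists_solvesNestedBellman`). One deterministic policy is discounted optimal
for arbitrarily small rates `x`; its value expands as `G / x + h + w x + O(x²)`, and comparing
coefficients in the optimality inequality gives the nested equations once `G` is constant. Weak
communication enters only there. -/

namespace Matrix

/-! ### Cesàro limits of the powers of a stochastic matrix. -/

variable {S : Type*} [Fintype S] [DecidableEq S] {K E : Matrix S S ℝ}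

/-- `E` is the Cesàro limit of the powers of `K`. -/
def IsCesaroLimit (K E : Matrix S S ℝ) : Prop :=
  ∀ (f : S → ℝ) (s : S),
    Tendsto (fun N : ℕ => (∑ k ∈ Finset.range N, (K ^ k *ᵥ f) s) / N) atTop (𝓝 ((E *ᵥ f) s))

theorem mulVec_mono_of_mem_rowStochastic (hK : K ∈ rowStochastic ℝ S) {f g : S → ℝ}
    (h : ∀ s, f s ≤ g s) (s : S) : (K *ᵥ f) s ≤ (K *ᵥ g) s :=
  Finset.sum_le_sum fun t _ => mul_le_mul_of_nonneg_left (h t) (nonneg_of_mem_rowStochastic hK)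

theorem mulVec_const_of_mem_rowStochastic (hK : K ∈ rowStochastic ℝ S) (c : ℝ) :
    (K *ᵥ fun _ => c) = fun _ => c := by
  funext s
  simp only [mulVec, dotProduct, ← Finset.sum_mul, sum_row_of_mem_rowStochastic hK, one_mul]

theorem abs_mulVec_le_of_mem_rowStochastic (hK : K ∈ rowStochastic ℝ S) (f : S → ℝ) (s : S) :
    |(K *ᵥ f) s| ≤ ‖f‖ := by
  have h : ∀ t, |f t| ≤ ‖f‖ := fun t => norm_le_pi_norm f t
  have h1 := mulVec_mono_of_mem_rowStochastic hK (fun t => (abs_le.1 (h t)).1) s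
  have h2 := mulVec_mono_of_mem_rowStochastic hK (fun t => (abs_le.1 (h t)).2) s
  rw [mulVec_const_of_mem_rowStochastic hK] at h1 h2
  exact abs_le.2 ⟨h1, h2⟩

theorem pow_mulVec_eq_self {f : S → ℝ} (h : K *ᵥ f = f) (n : ℕ) : K ^ n *ᵥ f = f := by
  induction n with
  | zero => simp
  | succ n ih => rw [pow_succ, ← mulVec_mulVec, h, ih]

theorem pow_mulVec_comp {S T : Type*} [Fintype S] [Fintype T] [DecidableEq S]
    [DecidableEq T] {K : Matrix T T ℝ} {L : Matrix S S ℝ} {p : T → S}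
    (h : ∀ (f : S → ℝ) (t : T), (K *ᵥ fun t' => f (p t')) t = (L *ᵥ f) (p t)) (f : S → ℝ) (n : ℕ)
    (t : T) : (K ^ n *ᵥ fun t' => f (p t')) t = (L ^ n *ᵥ f) (p t) := by
  induction n generalizing f with
  | zero => simp
  | succ n ih => rw [pow_succ, pow_succ, ← mulVec_mulVec, ← mulVec_mulVec, ← ih, ← funext (h f)]

theorem sum_range_pow_mulVec_sub (y : S → ℝ) (s : S) (n : ℕ) :
    ∑ k ∈ Finset.range n, (K ^ k *ᵥ (y - K *ᵥ y)) s = y s - (K ^ n *ᵥ y) s := by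
  induction n with
  | zero => simp
  | succ n ih =>
    rw [Finset.sum_range_succ, ih, mulVec_sub, mulVec_mulVec, ← pow_succ, Pi.sub_apply]
    ring

/-- Summing `K ^ k f` over `k < n` gives `n f` by invariance, but telescopes to `y - K ^ n y`, which
stays bounded. -/
theorem eq_zero_of_mulVec_eq_of_eq_sub (hK : K ∈ rowStochastic ℝ S) {f y : S → ℝ}
    (hf : K *ᵥ f = f) (hy : f = y - K *ᵥ y) : f = 0 := by
  funext s
  by_contra hne
  have hbound : ∀ n : ℕ, n * |f s| ≤ 2 * ‖y‖ := fun n => by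
    have h := sum_range_pow_mulVec_sub (K := K) y s n
    simp only [← hy, pow_mulVec_eq_self hf, Finset.sum_const, Finset.card_range,
      nsmul_eq_mul] at h
    have h1 := abs_mulVec_le_of_mem_rowStochastic (pow_mem hK n) y s
    have h2 : |y s| ≤ ‖y‖ := norm_le_pi_norm y s
    have h3 := abs_sub (y s) ((K ^ n *ᵥ y) s)
    rw [← h, abs_mul, Nat.abs_cast] at h3
    linarith
  have hpos : 0 < |f s| := abs_pos.2 hne
  obtain ⟨n, hn⟩ := exists_nat_gt (2 * ‖y‖ / |f s|)
  rw [div_lt_iff₀ hpos] at hn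
  exact absurd (hbound n) (not_le.2 hn)

/-- The ergodic decomposition into an invariant vector and a coboundary. -/
theorem exists_ergodic_decomposition (hK : K ∈ rowStochastic ℝ S) (f : S → ℝ) :
    ∃ f₀ y : S → ℝ, K *ᵥ f₀ = f₀ ∧ f = f₀ + (y - K *ᵥ y) := by
  let T : (S → ℝ) →ₗ[ℝ] (S → ℝ) := LinearMap.id - K.mulVecLin
  have hT : ∀ y, T y = y - K *ᵥ y := fun y => rfl
  have hdisj : Disjoint (LinearMap.ker T) (LinearMap.range T) := by
    rw [Submodule.disjoint_def]
    rintro x hx ⟨y, hy⟩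
    rw [LinearMap.mem_ker, hT, sub_eq_zero] at hx
    exact eq_zero_of_mulVec_eq_of_eq_sub hK hx.symm (hy.symm.trans (hT y))
  -- By rank-nullity the dimensions of kernel and range add up, so trivial intersection already
  -- gives a direct sum.
  have htop := Submodule.eq_top_of_disjoint _ _
    (by rw [add_comm]; exact (LinearMap.finrank_range_add_finrank_ker T).ge) hdisj
  obtain ⟨f₀, h₀, _, ⟨y, rfl⟩, hf⟩ := Submodule.mem_sup.1 (htop ▸ Submodule.mem_top : f ∈ _)
  rw [LinearMap.mem_ker, hT, sub_eq_zero] at h₀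
  exact ⟨f₀, y, h₀.symm, hf.symm⟩

theorem tendsto_cesaro_of_decomposition (hK : K ∈ rowStochastic ℝ S) {f₀ y : S → ℝ}
    (h₀ : K *ᵥ f₀ = f₀) (s : S) :
    Tendsto (fun N : ℕ => (∑ k ∈ Finset.range N, (K ^ k *ᵥ (f₀ + (y - K *ᵥ y))) s) / N) atTop
      (𝓝 (f₀ s)) := by
  have hlim : Tendsto (fun N : ℕ => f₀ s + (y s - (K ^ N *ᵥ y) s) / N) atTop (𝓝 (f₀ s + 0)) := by
    refine tendsto_const_nhds.add (squeeze_zero_norm (a := fun N : ℕ => 2 * ‖y‖ / N) (fun N => ?_)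
      (tendsto_const_div_atTop_nhds_zero_nat _))
    rw [Real.norm_eq_abs, abs_div, Nat.abs_cast]
    gcongr
    have h1 := abs_mulVec_le_of_mem_rowStochastic (pow_mem hK N) y s
    have h2 : |y s| ≤ ‖y‖ := norm_le_pi_norm y s
    have h3 := abs_sub (y s) ((K ^ N *ᵥ y) s)
    linarith
  rw [add_zero] at hlim
  refine hlim.congr' ?_
  filter_upwards [eventually_gt_atTop 0] with N hN
  have hN' : (N : ℝ) ≠ 0 := by positivity
  simp only [mulVec_add, Pi.add_apply, pow_mulVec_eq_self h₀, Finset.sum_add_distrib,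
    sum_range_pow_mulVec_sub, Finset.sum_const, Finset.card_range, nsmul_eq_mul]
  field_simp

theorem exists_isCesaroLimit (hK : K ∈ rowStochastic ℝ S) : ∃ E, IsCesaroLimit K E := by
  have h : ∀ f : S → ℝ, ∃ f₀ : S → ℝ, ∀ s,
      Tendsto (fun N : ℕ => (∑ k ∈ Finset.range N, (K ^ k *ᵥ f) s) / N) atTop (𝓝 (f₀ s)) := by
    intro f
    obtain ⟨f₀, y, h₀, rfl⟩ := exists_ergodic_decomposition hK f
    exact ⟨f₀, tendsto_cesaro_of_decomposition hK h₀⟩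
  choose F hF using h
  refine ⟨fun s t => F (Pi.single t 1) s, fun f s => ?_⟩
  have hsum := tendsto_finsetSum Finset.univ fun t _ => (hF (Pi.single t 1) s).mul_const (f t)
  refine hsum.congr fun N => ?_
  simp only [div_mul_eq_mul_div, Finset.sum_mul, ← Finset.sum_div]
  rw [Finset.sum_comm]
  refine congrArg (· / (N : ℝ)) (Finset.sum_congr rfl fun k _ => ?_)
  change _ = ∑ t, (K ^ k) s t * f t
  simp only [mulVec_single_one, col_apply]

namespace IsCesaroLimit

theorem mulVec_eq_of_decomposition (hE : IsCesaroLimit K E) (hK : K ∈ rowStochastic ℝ S)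
    {f₀ y : S → ℝ} (h₀ : K *ᵥ f₀ = f₀) : E *ᵥ (f₀ + (y - K *ᵥ y)) = f₀ :=
  funext fun s => tendsto_nhds_unique (hE _ s) (tendsto_cesaro_of_decomposition hK h₀ s)

theorem mulVec_of_invariant (hE : IsCesaroLimit K E) (hK : K ∈ rowStochastic ℝ S)
    {f : S → ℝ} (h : K *ᵥ f = f) : E *ᵥ f = f := by
  simpa using hE.mulVec_eq_of_decomposition hK (y := 0) h

theorem mulVec_sub_mulVec (hE : IsCesaroLimit K E) (hK : K ∈ rowStochastic ℝ S)
    (y : S → ℝ) : E *ᵥ (y - K *ᵥ y) = 0 := by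
  simpa using hE.mulVec_eq_of_decomposition hK (f₀ := 0) (y := y) (by simp)

theorem mulVec_mulVec_left (hE : IsCesaroLimit K E) (hK : K ∈ rowStochastic ℝ S)
    (f : S → ℝ) : K *ᵥ (E *ᵥ f) = E *ᵥ f := by
  obtain ⟨f₀, y, h₀, rfl⟩ := exists_ergodic_decomposition hK f
  rw [hE.mulVec_eq_of_decomposition hK h₀, h₀]

theorem mulVec_mulVec_right (hE : IsCesaroLimit K E) (hK : K ∈ rowStochastic ℝ S)
    (f : S → ℝ) : E *ᵥ (K *ᵥ f) = E *ᵥ f := by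
  have h := hE.mulVec_sub_mulVec hK f
  rw [mulVec_sub, sub_eq_zero] at h
  exact h.symm

theorem mulVec_mulVec_self (hE : IsCesaroLimit K E) (hK : K ∈ rowStochastic ℝ S)
    (f : S → ℝ) : E *ᵥ (E *ᵥ f) = E *ᵥ f :=
  hE.mulVec_of_invariant hK (hE.mulVec_mulVec_left hK f)

theorem mem_rowStochastic (hE : IsCesaroLimit K E) (hK : K ∈ rowStochastic ℝ S) :
    E ∈ rowStochastic ℝ S := by
  refine ⟨fun s t => ?_, hE.mulVec_of_invariant hK hK.2⟩
  have h := hE (Pi.single t 1) s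
  rw [mulVec_single_one, col_apply] at h
  refine ge_of_tendsto' h fun N => div_nonneg (Finset.sum_nonneg fun k _ => ?_) N.cast_nonneg
  rw [mulVec_single_one, col_apply]
  exact nonneg_of_mem_rowStochastic (pow_mem hK k)

/-- The Poisson equation is solvable for vectors with vanishing Cesàro limit. -/
theorem exists_poisson_solution (hE : IsCesaroLimit K E) (hK : K ∈ rowStochastic ℝ S)
    {f : S → ℝ} (hf : E *ᵥ f = 0) : ∃ y : S → ℝ, E *ᵥ y = 0 ∧ y - K *ᵥ y = f := by
  obtain ⟨f₀, y, h₀, rfl⟩ := exists_ergodic_decomposition hK f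
  rw [hE.mulVec_eq_of_decomposition hK h₀] at hf
  -- `E y` is invariant under `K`, so subtracting it normalizes the solution without changing the
  -- coboundary.
  refine ⟨y - E *ᵥ y, ?_, ?_⟩
  · rw [mulVec_sub, hE.mulVec_mulVec_self hK, sub_self]
  · rw [mulVec_sub, hE.mulVec_mulVec_left hK, hf]
    abel

/-- The partial sums of a coboundary `y - K y` with `E y = 0` converge to `y` in the Cesàro
sense. -/
theorem tendsto_cesaro_partial_sums (hE : IsCesaroLimit K E) (hK : K ∈ rowStochastic ℝ S)
    {y : S → ℝ} (hy : E *ᵥ y = 0) (s : S) :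
    Tendsto (fun N : ℕ => (∑ T ∈ Finset.Icc 1 N,
      ∑ t ∈ Finset.range T, (K ^ t *ᵥ (y - K *ᵥ y)) s) / N) atTop (𝓝 (y s)) := by
  -- The inner sums telescope to `y - K ^ T y`; since `T` starts at 1, the average runs over the
  -- powers of `K` applied to `K y`.
  have hlim := tendsto_const_nhds (x := y s).sub (hE (K *ᵥ y) s)
  rw [hE.mulVec_mulVec_right hK, hy, Pi.zero_apply, sub_zero] at hlim
  refine hlim.congr' ?_
  filter_upwards [eventually_gt_atTop 0] with N hN
  have hN' : (N : ℝ) ≠ 0 := by positivity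
  have hIcc : Finset.Icc 1 N = Finset.Ico 1 (N + 1) := by ext; simp
  simp only [sum_range_pow_mulVec_sub, mulVec_mulVec, ← pow_succ, hIcc,
    Finset.sum_Ico_eq_sum_range, Finset.sum_sub_distrib, Finset.sum_const, Nat.card_Ico,
    nsmul_eq_mul, Nat.add_sub_cancel, add_comm 1]
  field_simp

/-- A state with vanishing return probabilities is not charged by the Cesàro limit. -/
theorem apply_eq_zero_of_tendsto (hE : IsCesaroLimit K E) (hK : K ∈ rowStochastic ℝ S) {t : S}
    (ht : Tendsto (fun n : ℕ => (K ^ n) t t) atTop (𝓝 0)) (s : S) : E s t = 0 := by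
  have hEs := hE.mem_rowStochastic hK
  have hnn : ∀ s t, 0 ≤ E s t := hEs.1
  have htt : E t t = 0 := by
    have h := hE (Pi.single t 1) t
    simp only [mulVec_single_one, col_apply] at h
    have h' := ht.cesaro
    simp only [inv_mul_eq_div] at h'
    exact tendsto_nhds_unique h h'
  have hfix : ∀ u, ∑ v, E u v * E v t = E u t := fun u => by
    have h := congrFun (hE.mulVec_mulVec_self hK (Pi.single t 1)) u
    rwa [mulVec_single_one] at h
  have : Nonempty S := ⟨s⟩
  -- Maximum principle on the column of `t`: every state charged from the maximizer `m` also attains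
  -- the maximum. For `t` itself, where the value is 0, this reads `E m t * E m t = 0`.
  obtain ⟨m, hm⟩ := Finite.exists_max fun u => E u t
  have hzero : ∑ v, E m v * (E m t - E v t) = 0 := by
    simp only [mul_sub, Finset.sum_sub_distrib, ← Finset.sum_mul, hfix,
      sum_row_of_mem_rowStochastic hEs, one_mul, sub_self]
  have hterm := (Finset.sum_eq_zero_iff_of_nonneg fun v _ =>
    mul_nonneg (hnn m v) (sub_nonneg.2 (hm v))).1 hzero t (Finset.mem_univ t)
  rw [htt, sub_zero, mul_self_eq_zero] at hterm
  exact le_antisymm (hterm ▸ hm s) (hnn s t)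

end IsCesaroLimit

end Matrix

/-! ### Gain, bias and verification by the nested optimality equations. -/

namespace FiniteMDP

open Matrix
open scoped Classical

theorem detPolicy_sum {S A : Type*} [Fintype A] (d : S → A) (s : S) (f : A → ℝ) :
    ∑ a, (detPolicy d s).1 a * f a = f (d s) := by
  simp [detPolicy, Pi.single_apply]

variable {S A : Type*} [Fintype S] [Fintype A] {D : FiniteMDP S A} {π : Policy S A}
  {E : Matrix S S ℝ} {g : ℝ} {h w : S → ℝ}

theorem chain_mulVec (D : FiniteMDP S A) (π : Policy S A) (f : S → ℝ) (s : S) :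
    (D.chain π *ᵥ f) s = ∑ a, (π s).1 a * ∑ s', D.P s a s' * f s' := by
  simp only [chain, mulVec, dotProduct, Finset.sum_mul, Finset.mul_sum]
  rw [Finset.sum_comm]
  simp only [mul_assoc]

theorem chain_detPolicy_mulVec (D : FiniteMDP S A) (d : S → A) (f : S → ℝ) (s : S) :
    (D.chain (detPolicy d) *ᵥ f) s = ∑ s', D.P s (d s) s' * f s' := by
  rw [chain_mulVec, detPolicy_sum d s fun a => ∑ s', D.P s a s' * f s']

theorem polReward_detPolicy (D : FiniteMDP S A) (d : S → A) (s : S) :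
    D.polReward (detPolicy d) s = D.r s (d s) :=
  detPolicy_sum d s (D.r s)

theorem chain_mem_rowStochastic (D : FiniteMDP S A) (π : Policy S A) :
    D.chain π ∈ rowStochastic ℝ S := by
  refine ⟨fun s s' => Finset.sum_nonneg fun a _ => mul_nonneg ((π s).2.1 a) (D.P_nonneg s a s'),
    funext fun s => ?_⟩
  simp [chain_mulVec, D.P_sum, (π s).2.2]

theorem expect_comp {T : Type*} [Fintype T] {D' : FiniteMDP T A} {π' : Policy T A} {p : T → S}
    (hp : ∀ (f : S → ℝ) (t : T),
      (D'.chain π' *ᵥ fun t' => f (p t')) t = (D.chain π *ᵥ f) (p t))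
    (f : S → ℝ) (n : ℕ) (t : T) :
    D'.expect π' (fun t' => f (p t')) n t = D.expect π f n (p t) :=
  pow_mulVec_comp hp f n t

theorem tendsto_value_div (hE : IsCesaroLimit (D.chain π) E) (s : S) :
    Tendsto (fun T : ℕ => D.value π T s / T) atTop (𝓝 ((E *ᵥ D.polReward π) s)) :=
  hE (D.polReward π) s

theorem gain_eq (hE : IsCesaroLimit (D.chain π) E) : D.gain π = E *ᵥ D.polReward π :=
  funext fun s => (tendsto_value_div hE s).limUnder_eq

theorem tendsto_gain (D : FiniteMDP S A) (π : Policy S A) (s : S) :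
    Tendsto (fun T : ℕ => D.value π T s / T) atTop (𝓝 (D.gain π s)) := by
  obtain ⟨E, hE⟩ := exists_isCesaroLimit (D.chain_mem_rowStochastic π)
  rw [gain_eq hE]
  exact tendsto_value_div hE s

theorem tendsto_biasMean_of_poisson (hE : IsCesaroLimit (D.chain π) E) {y : S → ℝ}
    (hy : E *ᵥ y = 0) (hp : y - D.chain π *ᵥ y = D.polReward π - D.gain π) (s : S) :
    Tendsto (fun N : ℕ => D.biasMean π N s) atTop (𝓝 (y s)) := by
  have hlim := hE.tendsto_cesaro_partial_sums (D.chain_mem_rowStochastic π) hy s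
  rw [hp] at hlim
  exact hlim

theorem bias_eq_of_poisson (hE : IsCesaroLimit (D.chain π) E) {y : S → ℝ}
    (hy : E *ᵥ y = 0) (hp : y - D.chain π *ᵥ y = D.polReward π - D.gain π) : D.bias π = y :=
  funext fun s => (tendsto_biasMean_of_poisson hE hy hp s).limUnder_eq

/-- The bias solves the Poisson equation and has vanishing Cesàro limit. -/
theorem bias_spec (hE : IsCesaroLimit (D.chain π) E) :
    E *ᵥ D.bias π = 0 ∧ D.bias π - D.chain π *ᵥ D.bias π = D.polReward π - D.gain π := by
  have hK := D.chain_mem_rowStochastic π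
  obtain ⟨y, hy, hp⟩ := hE.exists_poisson_solution hK (f := D.polReward π - D.gain π) (by
    rw [mulVec_sub, gain_eq hE, hE.mulVec_mulVec_self hK, sub_self])
  rw [bias_eq_of_poisson hE hy hp]
  exact ⟨hy, hp⟩

theorem tendsto_bias (D : FiniteMDP S A) (π : Policy S A) (s : S) :
    Tendsto (fun N : ℕ => D.biasMean π N s) atTop (𝓝 (D.bias π s)) := by
  obtain ⟨E, hE⟩ := exists_isCesaroLimit (D.chain_mem_rowStochastic π)
  exact tendsto_biasMean_of_poisson hE (bias_spec hE).1 (bias_spec hE).2 s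

theorem solvesBellman_iff [Nonempty A] :
    D.SolvesBellman g h ↔ (∀ s a, D.r s a + ∑ s', D.P s a s' * h s' ≤ g + h s) ∧
      ∀ s, ∃ a, D.r s a + ∑ s', D.P s a s' * h s' = g + h s := by
  have hbdd : ∀ s, BddAbove (Set.range fun a => D.r s a + ∑ s', D.P s a s' * h s') :=
    fun s => Set.finite_range _ |>.bddAbove
  simp only [SolvesBellman, bellman, sub_eq_iff_eq_add]
  constructor
  · intro H
    refine ⟨fun s a => (le_ciSup (hbdd s) a).trans (H s).le, fun s => ?_⟩
    obtain ⟨a, ha⟩ := exists_eq_ciSup_of_finite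
      (f := fun a => D.r s a + ∑ s', D.P s a s' * h s')
    exact ⟨a, ha.trans (H s)⟩
  · rintro ⟨hle, heq⟩ s
    obtain ⟨a, ha⟩ := heq s
    exact le_antisymm (ciSup_le (hle s)) (ha.ge.trans (le_ciSup (hbdd s) a))

/-- The nested optimality equations of gain and bias: `h` solves the Bellman equation with gain
`g`, and `w` solves `w + h = max P w`, the maximum being over the actions which attain the
maximum in the Bellman equation. -/
structure SolvesNestedBellman (D : FiniteMDP S A) (g : ℝ) (h w : S → ℝ) : Prop where
  le : ∀ s a, D.r s a + ∑ s', D.P s a s' * h s' ≤ g + h s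
  le_of_eq : ∀ s a, D.r s a + ∑ s', D.P s a s' * h s' = g + h s →
    ∑ s', D.P s a s' * w s' ≤ w s + h s
  exists_eq : ∀ s, ∃ a, D.r s a + ∑ s', D.P s a s' * h s' = g + h s ∧
    ∑ s', D.P s a s' * w s' = w s + h s

namespace SolvesNestedBellman

theorem solvesBellman [Nonempty A] (H : D.SolvesNestedBellman g h w) : D.SolvesBellman g h :=
  solvesBellman_iff.2 ⟨H.le, fun s => (H.exists_eq s).imp fun _ => And.left⟩

/-- The loss in the Bellman equation incurred by a policy, as a weighted sum over actions. -/
theorem sub_eq_sum (D : FiniteMDP S A) (π : Policy S A) (g : ℝ) (h : S → ℝ) (s : S) :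
    g + h s - (D.polReward π s + (D.chain π *ᵥ h) s) =
      ∑ a, (π s).1 a * (g + h s - (D.r s a + ∑ s', D.P s a s' * h s')) := by
  simp only [mul_sub, mul_add, Finset.sum_sub_distrib, Finset.sum_add_distrib, ← Finset.sum_mul,
    (π s).2.2, chain_mulVec, polReward, one_mul]

theorem polReward_add_le (H : D.SolvesNestedBellman g h w) (π : Policy S A) (s : S) :
    D.polReward π s + (D.chain π *ᵥ h) s ≤ g + h s := by
  rw [← sub_nonneg, sub_eq_sum]
  exact Finset.sum_nonneg fun a _ => mul_nonneg ((π s).2.1 a) (sub_nonneg.2 (H.le s a))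

/-- The loss is an average of nonnegative losses of actions, so if it vanishes the policy plays only
maximizing actions, to which the second equation applies. -/
theorem chain_mulVec_le (H : D.SolvesNestedBellman g h w) {s : S}
    (hs : D.polReward π s + (D.chain π *ᵥ h) s = g + h s) :
    (D.chain π *ᵥ w) s ≤ w s + h s := by
  have hz := sub_eq_sum D π g h s
  rw [hs, sub_self, eq_comm, Finset.sum_eq_zero_iff_of_nonneg fun a _ =>
    mul_nonneg ((π s).2.1 a) (sub_nonneg.2 (H.le s a))] at hz
  have hsum : w s + h s = ∑ a, (π s).1 a * (w s + h s) := by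
    rw [← Finset.sum_mul, (π s).2.2, one_mul]
  rw [hsum, chain_mulVec]
  refine Finset.sum_le_sum fun a ha => ?_
  rcases mul_eq_zero.1 (hz a ha) with h0 | h0
  · rw [h0, zero_mul, zero_mul]
  · exact mul_le_mul_of_nonneg_left (H.le_of_eq s a (sub_eq_zero.1 h0).symm) ((π s).2.1 a)

/-- `E` annihilates the coboundary of `h`, fixes constants and sends the reward to the gain. -/
theorem mulVec_loss (hE : IsCesaroLimit (D.chain π) E) (g : ℝ) (h : S → ℝ) :
    E *ᵥ (fun s => g + h s - (D.polReward π s + (D.chain π *ᵥ h) s)) =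
      fun s => g - D.gain π s := by
  have hK := D.chain_mem_rowStochastic π
  have hdec : (fun s => g + h s - (D.polReward π s + (D.chain π *ᵥ h) s)) =
      (fun _ => g) - D.polReward π + (h - D.chain π *ᵥ h) := by
    funext s
    simp only [Pi.sub_apply, Pi.add_apply]
    ring
  rw [hdec, mulVec_add, mulVec_sub, hE.mulVec_sub_mulVec hK, ← gain_eq hE,
    mulVec_const_of_mem_rowStochastic (hE.mem_rowStochastic hK), add_zero]
  rfl

theorem gain_le (H : D.SolvesNestedBellman g h w) (π : Policy S A) (s : S) :
    D.gain π s ≤ g := by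
  obtain ⟨E, hE⟩ := exists_isCesaroLimit (D.chain_mem_rowStochastic π)
  have hnn := nonneg_mulVec_of_mem_rowStochastic
    (hE.mem_rowStochastic (D.chain_mem_rowStochastic π))
    (fun s => sub_nonneg.2 (H.polReward_add_le π s)) s
  rw [mulVec_loss hE] at hnn
  exact sub_nonneg.1 hnn

/-- A gain-optimal policy has zero loss at every state charged by `E`. There `h ≥ K w - w`, and
averaging by `E` gives `E h ≥ 0`, whereas `E` annihilates the bias. -/
theorem bias_le (H : D.SolvesNestedBellman g h w) (hπ : ∀ s, D.gain π s = g) (s : S) :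
    D.bias π s ≤ h s := by
  have hK := D.chain_mem_rowStochastic π
  obtain ⟨E, hE⟩ := exists_isCesaroLimit hK
  have hEs := hE.mem_rowStochastic hK
  obtain ⟨hb0, hb⟩ := bias_spec hE
  have hloss := mulVec_loss hE g h
  simp only [hπ, sub_self] at hloss
  have htight : ∀ s t, E s t ≠ 0 → D.polReward π t + (D.chain π *ᵥ h) t = g + h t := by
    intro s t hst
    have hz := (Finset.sum_eq_zero_iff_of_nonneg fun t _ =>
      mul_nonneg (hEs.1 s t) (sub_nonneg.2 (H.polReward_add_le π t))).1 (congrFun hloss s) t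
        (Finset.mem_univ t)
    exact (sub_eq_zero.1 ((mul_eq_zero.1 hz).resolve_left hst)).symm
  have hEh : ∀ s, 0 ≤ (E *ᵥ h) s := by
    intro s
    have h0 : (E *ᵥ (w - D.chain π *ᵥ w)) s = 0 := congrFun (hE.mulVec_sub_mulVec hK w) s
    rw [← neg_nonpos, ← h0, ← Pi.neg_apply, ← mulVec_neg]
    refine Finset.sum_le_sum fun t _ => ?_
    change E s t * (-h) t ≤ E s t * (w - D.chain π *ᵥ w) t
    by_cases hst : E s t = 0
    · rw [hst, zero_mul, zero_mul]
    · have hw := H.chain_mulVec_le (htight s t hst)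
      refine mul_le_mul_of_nonneg_left ?_ (hEs.1 s t)
      simp only [Pi.neg_apply, Pi.sub_apply]
      linarith
  -- `u = h - bias` is superharmonic, so it dominates its Cesàro limit.
  set u : S → ℝ := h - D.bias π with hu
  have hsuper : ∀ t, (D.chain π *ᵥ u) t ≤ u t := by
    intro t
    have h1 := H.polReward_add_le π t
    have h2 := congrFun hb t
    simp only [Pi.sub_apply, hπ] at h2
    rw [hu, mulVec_sub]
    simp only [Pi.sub_apply]
    linarith
  have hpow : ∀ (n : ℕ) (t : S), (D.chain π ^ n *ᵥ u) t ≤ u t := by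
    intro n
    induction n with
    | zero => simp
    | succ n ih =>
      intro t
      rw [pow_succ, ← mulVec_mulVec]
      exact (mulVec_mono_of_mem_rowStochastic (pow_mem hK n) hsuper t).trans (ih t)
  have hEu : (E *ᵥ u) s ≤ u s := by
    refine le_of_tendsto (hE u s) ?_
    filter_upwards [eventually_gt_atTop 0] with N hN
    rw [div_le_iff₀ (by positivity)]
    refine (Finset.sum_le_sum fun k _ => hpow k s).trans ?_
    simp [mul_comm]
  rw [hu, mulVec_sub, hb0, sub_zero] at hEu
  exact sub_nonneg.1 ((hEh s).trans hEu)

/-- Actions attaining both maxima work. The first equality is the Poisson equation; the second makes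
`h` a coboundary, hence `E h = 0`, the normalization that singles out the bias. -/
theorem exists_policy (H : D.SolvesNestedBellman g h w) :
    ∃ π : Policy S A, (∀ s, D.gain π s = g) ∧ D.bias π = h := by
  choose d hd hdw using H.exists_eq
  have hK := D.chain_mem_rowStochastic (detPolicy d)
  obtain ⟨E, hE⟩ := exists_isCesaroLimit hK
  have hgain : ∀ s, D.gain (detPolicy d) s = g := by
    have hloss := mulVec_loss hE g h
    simp only [chain_detPolicy_mulVec, polReward_detPolicy, hd, sub_self] at hloss
    intro s
    have hs := congrFun hloss s
    rw [show (fun _ : S => (0 : ℝ)) = 0 from rfl, mulVec_zero] at hs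
    exact (sub_eq_zero.1 hs.symm).symm
  refine ⟨detPolicy d, hgain, bias_eq_of_poisson hE ?_ ?_⟩
  · have hwh : w - D.chain (detPolicy d) *ᵥ w = -h := by
      funext s
      simp only [Pi.sub_apply, Pi.neg_apply, chain_detPolicy_mulVec, hdw]
      ring
    have h0 := hE.mulVec_sub_mulVec hK w
    rwa [hwh, mulVec_neg, neg_eq_zero] at h0
  · funext s
    have hs := hd s
    simp only [Pi.sub_apply, chain_detPolicy_mulVec, polReward_detPolicy, hgain]
    linarith

theorem isOptimalPolicy_iff (H : D.SolvesNestedBellman g h w) :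
    D.IsOptimalPolicy π ↔ ∀ s, D.gain π s = g := by
  refine ⟨fun hπ s => le_antisymm (H.gain_le π s) ?_, fun hπ π' s => (hπ s).symm ▸ H.gain_le π' s⟩
  obtain ⟨π', hg, -⟩ := H.exists_policy
  exact hg s ▸ hπ π' s

theorem isOptimalGain (H : D.SolvesNestedBellman g h w) : D.IsOptimalGain g := by
  intro s
  obtain ⟨π, hg, -⟩ := H.exists_policy
  exact IsGreatest.isLUB ⟨⟨π, hg s⟩, by rintro _ ⟨π', rfl⟩; exact H.gain_le π' s⟩

theorem isOptimalBias (H : D.SolvesNestedBellman g h w) : D.IsOptimalBias h := by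
  obtain ⟨π, hg, hb⟩ := H.exists_policy
  exact ⟨⟨π, H.isOptimalPolicy_iff.2 hg, hb⟩,
    fun π' hπ' s => H.bias_le (H.isOptimalPolicy_iff.1 hπ') s⟩

end SolvesNestedBellman

end FiniteMDP

/-! ### Vanishing discount and existence of a certificate. -/

theorem nonneg_of_frequently_nonneg {f : ℝ → ℝ} (hf : Continuous f)
    (H : ∃ᶠ x in 𝓝[>] (0 : ℝ), 0 ≤ f x) : 0 ≤ f 0 :=
  ge_of_tendsto_of_frequently ((hf.tendsto 0).mono_left nhdsWithin_le_nhds) H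

/-- A Laurent polynomial which is nonnegative for arbitrarily small positive arguments has a
lexicographically nonnegative vector of coefficients. -/
theorem laurent_lexicographic_nonneg {a b c e : ℝ}
    (H : ∃ᶠ x in 𝓝[>] (0 : ℝ), 0 ≤ a / x + b + c * x + e * x ^ 2) :
    0 ≤ a ∧ (a = 0 → 0 ≤ b ∧ (b = 0 → 0 ≤ c)) := by
  have hpos : ∀ᶠ x in 𝓝[>] (0 : ℝ), 0 < x := self_mem_nhdsWithin
  refine ⟨?_, ?_⟩
  · have h := nonneg_of_frequently_nonneg (f := fun x => a + b * x + c * x ^ 2 + e * x ^ 3)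
      (by fun_prop) ((H.and_eventually hpos).mono fun x ⟨hx, h0⟩ => by
        have hm := mul_nonneg h0.le hx
        have : x * (a / x + b + c * x + e * x ^ 2) = a + b * x + c * x ^ 2 + e * x ^ 3 := by
          field_simp
        rwa [this] at hm)
    simpa using h
  · rintro rfl
    refine ⟨?_, ?_⟩
    · have h := nonneg_of_frequently_nonneg (f := fun x => b + c * x + e * x ^ 2)
        (by fun_prop) (H.mono fun x hx => by simpa using hx)
      simpa using h
    · rintro rfl
      have h := nonneg_of_frequently_nonneg (f := fun x => c + e * x)
        (by fun_prop) ((H.and_eventually hpos).mono fun x ⟨hx, h0⟩ => by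
          refine nonneg_of_mul_nonneg_right (?_ : 0 ≤ x * (c + e * x)) h0
          convert hx using 1
          ring)
      simpa using h

namespace FiniteMDP

open Matrix
open scoped Classical

variable {S A : Type*} [Fintype S] {D : FiniteMDP S A}

theorem sum_P_mul_le (D : FiniteMDP S A) (s : S) (a : A) {f : S → ℝ} {c : ℝ}
    (hf : ∀ s', f s' ≤ c) : ∑ s', D.P s a s' * f s' ≤ c := by
  calc ∑ s', D.P s a s' * f s' ≤ ∑ s', D.P s a s' * c :=
        Finset.sum_le_sum fun s' _ => mul_le_mul_of_nonneg_left (hf s') (D.P_nonneg s a s')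
    _ = c := by rw [← Finset.sum_mul, D.P_sum, one_mul]

theorem sum_P_mul_const (D : FiniteMDP S A) (s : S) (a : A) (c : ℝ) :
    ∑ s', D.P s a s' * c = c := by
  rw [← Finset.sum_mul, D.P_sum, one_mul]

variable [Fintype A]

/-- `u` and the deterministic policy `d` solve the discounted optimality equation with discount
factor `1 / (1 + x)`. -/
def SolvesDiscounted (D : FiniteMDP S A) (d : S → A) (x : ℝ) (u : S → ℝ) : Prop :=
  (∀ s a, D.r s a + ∑ s', D.P s a s' * u s' ≤ (1 + x) * u s) ∧
    ∀ s, D.r s (d s) + ∑ s', D.P s (d s) s' * u s' = (1 + x) * u s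

/-- Divided by `1 + x`, the Bellman operator is a sup-norm contraction; `d` is greedy for its fixed
point. -/
theorem exists_solvesDiscounted [Nonempty A] (D : FiniteMDP S A) {x : ℝ} (hx : 0 < x) :
    ∃ d u, D.SolvesDiscounted d x u := by
  have hbdd : ∀ (u : S → ℝ) (s : S),
      BddAbove (Set.range fun a => D.r s a + ∑ s', D.P s a s' * u s') :=
    fun u s => (Set.finite_range _).bddAbove
  let T : (S → ℝ) → (S → ℝ) := fun u s => (1 + x)⁻¹ * D.bellman u s
  have hstep : ∀ (u v : S → ℝ) (s : S), D.bellman u s ≤ D.bellman v s + ‖u - v‖ := by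
    intro u v s
    refine ciSup_le fun a => ?_
    have h1 := le_ciSup (hbdd v s) a
    have h2 := D.sum_P_mul_le s a (f := u - v) fun s' =>
      (le_abs_self _).trans (norm_le_pi_norm (u - v) s')
    simp only [Pi.sub_apply, mul_sub, Finset.sum_sub_distrib] at h2
    simp only [bellman]
    linarith
  have hc : 0 ≤ (1 + x)⁻¹ := by positivity
  have hT : ContractingWith (Real.toNNReal (1 + x)⁻¹) T := by
    refine ⟨?_, LipschitzWith.of_dist_le_mul fun u v => ?_⟩
    · exact Real.toNNReal_lt_one.2 (inv_lt_one_of_one_lt₀ (by linarith))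
    · rw [Real.coe_toNNReal _ hc]
      rw [dist_pi_le_iff (by positivity)]
      intro s
      have h1 := hstep u v s
      have h2 := hstep v u s
      rw [norm_sub_rev] at h2
      rw [Real.dist_eq, ← mul_sub, abs_mul, abs_of_nonneg hc, dist_eq_norm]
      exact mul_le_mul_of_nonneg_left (abs_le.2 ⟨by linarith, by linarith⟩) hc
  have hfix := hT.fixedPoint_isFixedPt
  set u := hT.fixedPoint
  have hu : ∀ s, D.bellman u s = (1 + x) * u s := fun s => by
    have hs : (1 + x)⁻¹ * D.bellman u s = u s := congrFun hfix s
    rw [← hs]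
    field_simp
  have hex : ∀ s, ∃ a, D.r s a + ∑ s', D.P s a s' * u s' = D.bellman u s := fun s =>
    exists_eq_ciSup_of_finite (f := fun a => D.r s a + ∑ s', D.P s a s' * u s')
  choose d hd using hex
  exact ⟨d, u, fun s a => hu s ▸ le_ciSup (hbdd u s) a, fun s => hu s ▸ hd s⟩

/-- One deterministic policy is discounted optimal for discount factors arbitrarily close
to `1`. -/
theorem exists_frequently_solvesDiscounted [Nonempty A] (D : FiniteMDP S A) :
    ∃ d : S → A, ∃ᶠ x in 𝓝[>] (0 : ℝ), ∃ u, D.SolvesDiscounted d x u := by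
  by_contra hcon
  simp only [not_exists, not_frequently] at hcon
  -- There are finitely many deterministic policies: if each failed for all small rates, some common
  -- rate would have no optimal one.
  have hall := eventually_all.2 hcon
  have hpos : ∀ᶠ x in 𝓝[>] (0 : ℝ), 0 < x := self_mem_nhdsWithin
  obtain ⟨x, hx, h0⟩ := (hall.and hpos).exists
  obtain ⟨d, u, hu⟩ := D.exists_solvesDiscounted h0
  exact hx d u hu

/-- An excessive function which is invariant under some policy is constant in a weakly
communicating decision process. -/
theorem WeaklyCommunicating.exists_eq_const [Nonempty S] (hwc : D.WeaklyCommunicating)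
    {π : Policy S A} {f : S → ℝ} (hf : D.chain π *ᵥ f = f)
    (hsup : ∀ s a, ∑ s', D.P s a s' * f s' ≤ f s) : ∃ c, ∀ s, f s = c := by
  obtain ⟨C, hclosed, hcomm, htrans⟩ := hwc
  have hK := D.chain_mem_rowStochastic π
  obtain ⟨E, hE⟩ := exists_isCesaroLimit hK
  have hEs := hE.mem_rowStochastic hK
  have hE0 : ∀ s, ∀ t ∉ C, E s t = 0 := fun s t ht =>
    hE.apply_eq_zero_of_tendsto hK (htrans t ht π).tendsto_atTop_zero s
  have hCne : C.Nonempty := by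
    by_contra hC
    rw [Set.not_nonempty_iff_eq_empty] at hC
    obtain ⟨s⟩ := ‹Nonempty S›
    have h1 := sum_row_of_mem_rowStochastic hEs s
    rw [Finset.sum_eq_zero fun t _ => hE0 s t (by simp [hC])] at h1
    exact zero_ne_one h1
  obtain ⟨m, hmC, hm⟩ := Set.exists_min_image C f C.toFinite hCne
  -- From the minimizer `m` of `f` on `C`, the chain stays in `C` while the expectation of `f`
  -- cannot exceed `f m`; so every state reached has the value `f m`.
  have hconst : ∀ s ∈ C, f s = f m := by
    intro s hs
    obtain ⟨d, n, hn⟩ := hcomm m hmC s hs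
    set L := D.chain (detPolicy d) with hL
    have hLs : L ∈ rowStochastic ℝ S := D.chain_mem_rowStochastic _
    have hLC : ∀ n, ∀ s ∈ C, ∀ t ∉ C, (L ^ n) s t = 0 := by
      intro n
      induction n with
      | zero =>
        intro s hs t ht
        rw [pow_zero, one_apply_ne]
        rintro rfl
        exact ht hs
      | succ n ih =>
        intro s hs t ht
        rw [pow_succ, mul_apply]
        refine Finset.sum_eq_zero fun v _ => ?_
        by_cases hv : v ∈ C
        · rw [show L v t = D.P v (d v) t from detPolicy_sum d v fun a => D.P v a t,
            hclosed v hv (d v) t ht, mul_zero]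
        · rw [ih s hs v hv, zero_mul]
    have hLf : ∀ (n : ℕ) (t : S), (L ^ n *ᵥ f) t ≤ f t := by
      intro n
      induction n with
      | zero => simp
      | succ n ih =>
        intro t
        rw [pow_succ, ← mulVec_mulVec]
        refine (mulVec_mono_of_mem_rowStochastic (pow_mem hLs n) (fun v => ?_) t).trans (ih t)
        rw [hL, chain_detPolicy_mulVec]
        exact hsup v (d v)
    have hnn : ∀ t, 0 ≤ (L ^ n) m t * (f t - f m) := by
      intro t
      by_cases ht : t ∈ C
      · exact mul_nonneg ((pow_mem hLs n).1 m t) (sub_nonneg.2 (hm t ht))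
      · rw [hLC n m hmC t ht, zero_mul]
    have hle : ∑ t, (L ^ n) m t * (f t - f m) ≤ 0 := by
      simp only [mul_sub, Finset.sum_sub_distrib, ← Finset.sum_mul,
        sum_row_of_mem_rowStochastic (pow_mem hLs n), one_mul]
      exact sub_nonpos.2 (hLf n m)
    have hz := (Finset.sum_eq_zero_iff_of_nonneg fun t _ => hnn t).1
      (le_antisymm hle (Finset.sum_nonneg fun t _ => hnn t)) s (Finset.mem_univ s)
    exact sub_eq_zero.1 ((mul_eq_zero.1 hz).resolve_left hn.ne')
  -- Outside `C`, use `f = E f`: the rows of `E` are supported in `C`.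
  refine ⟨f m, fun s => ?_⟩
  have hEf := congrFun (hE.mulVec_of_invariant hK hf) s
  have hEc := congrFun (mulVec_const_of_mem_rowStochastic hEs (f m)) s
  rw [← hEf, ← hEc]
  refine Finset.sum_congr rfl fun t _ => ?_
  change E s t * f t = E s t * f m
  by_cases ht : t ∈ C
  · rw [hconst t ht]
  · rw [hE0 s t ht, zero_mul, zero_mul]

/-- The truncated Laurent expansion of a discounted value function. -/
theorem abs_discounted_sub_laurent_le {d : S → A} {x : ℝ} {u g h w y : S → ℝ} (hx : 0 < x)
    (hu : D.SolvesDiscounted d x u) (hg : D.chain (detPolicy d) *ᵥ g = g)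
    (hh : h - D.chain (detPolicy d) *ᵥ h = D.polReward (detPolicy d) - g)
    (hw : w - D.chain (detPolicy d) *ᵥ w = -h)
    (hy : y - D.chain (detPolicy d) *ᵥ y = -w) (s : S) :
    |u s - (g s / x + h s + w s * x)| ≤ 2 * ‖y‖ * x ^ 2 := by
  have hK := D.chain_mem_rowStochastic (detPolicy d)
  set K := D.chain (detPolicy d) with hKdef
  set e : S → ℝ := u - (x⁻¹ • g + h + x • w + x ^ 2 • y) with he
  -- With the term `x² y` included, the Poisson equations cancel every order below `x³`. Comparing
  -- norms then gives `x ‖e‖ ≤ x³ ‖y‖`, which costs one power of `x`.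
  have hes : ∀ s, (1 + x) * e s = (K *ᵥ e) s - x ^ 3 * y s := by
    intro s
    have h1 := hu.2 s
    rw [← chain_detPolicy_mulVec, ← polReward_detPolicy, ← hKdef] at h1
    have h2 := congrFun hh s
    have h3 := congrFun hw s
    have h4 := congrFun hy s
    simp only [Pi.sub_apply, Pi.neg_apply] at h2 h3 h4
    simp only [he, mulVec_sub, mulVec_add, mulVec_smul, hg, Pi.sub_apply, Pi.add_apply,
      Pi.smul_apply, smul_eq_mul]
    have hxx : x * x⁻¹ = 1 := mul_inv_cancel₀ hx.ne'
    linear_combination -h1 - h2 - x * h3 - x ^ 2 * h4 - g s * hxx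
  have hnorm : ‖e‖ ≤ x ^ 2 * ‖y‖ := by
    have hb : (1 + x) * ‖e‖ ≤ ‖e‖ + x ^ 3 * ‖y‖ := by
      have hx1 : 0 ≤ 1 + x := by positivity
      have h0 : ‖(1 + x) • e‖ ≤ ‖e‖ + x ^ 3 * ‖y‖ := by
        refine (pi_norm_le_iff_of_nonneg (by positivity)).2 fun s => ?_
        rw [Pi.smul_apply, smul_eq_mul, hes s, Real.norm_eq_abs]
        refine (abs_sub _ _).trans (add_le_add (abs_mulVec_le_of_mem_rowStochastic hK e s) ?_)
        rw [abs_mul, abs_of_pos (by positivity : 0 < x ^ 3)]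
        exact mul_le_mul_of_nonneg_left (norm_le_pi_norm y s) (by positivity)
      rwa [norm_smul, Real.norm_eq_abs, abs_of_nonneg hx1] at h0
    have hb' : x * ‖e‖ ≤ x * (x ^ 2 * ‖y‖) := by linarith
    exact le_of_mul_le_mul_left hb' hx
  have heq : u s - (g s / x + h s + w s * x) = e s + x ^ 2 * y s := by
    simp only [he, Pi.sub_apply, Pi.add_apply, Pi.smul_apply, smul_eq_mul]
    ring
  rw [heq]
  have h1 : |e s| ≤ x ^ 2 * ‖y‖ := (norm_le_pi_norm e s).trans hnorm
  have h2 : |y s| ≤ ‖y‖ := norm_le_pi_norm y s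
  refine (abs_add_le _ _).trans ?_
  rw [abs_mul, abs_of_nonneg (by positivity : 0 ≤ x ^ 2)]
  have h3 := mul_le_mul_of_nonneg_left h2 (by positivity : 0 ≤ x ^ 2)
  linarith

/-- The nested optimality equations are solvable in a weakly communicating decision process. -/
theorem WeaklyCommunicating.exists_solvesNestedBellman [Nonempty S] [Nonempty A]
    (hwc : D.WeaklyCommunicating) : ∃ g h w, D.SolvesNestedBellman g h w := by
  obtain ⟨d, hd⟩ := D.exists_frequently_solvesDiscounted
  have hK := D.chain_mem_rowStochastic (detPolicy d)
  obtain ⟨E, hE⟩ := exists_isCesaroLimit hK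
  set G := D.gain (detPolicy d) with hG
  have hKG : D.chain (detPolicy d) *ᵥ G = G := by
    rw [hG, gain_eq hE, hE.mulVec_mulVec_left hK]
  obtain ⟨hh0, hh⟩ := bias_spec hE
  set h := D.bias (detPolicy d)
  obtain ⟨w, hw0, hw⟩ := hE.exists_poisson_solution hK (f := -h) (by rw [mulVec_neg, hh0, neg_zero])
  obtain ⟨y, -, hy⟩ := hE.exists_poisson_solution hK (f := -w) (by rw [mulVec_neg, hw0, neg_zero])
  have hlex : ∀ s a, 0 ≤ G s - ∑ s', D.P s a s' * G s' ∧
      (G s - ∑ s', D.P s a s' * G s' = 0 →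
        0 ≤ G s + h s - (D.r s a + ∑ s', D.P s a s' * h s') ∧
        (G s + h s - (D.r s a + ∑ s', D.P s a s' * h s') = 0 →
          0 ≤ w s + h s - ∑ s', D.P s a s' * w s')) := by
    intro s a
    -- The `x²` coefficient collects `w s` from the product `(1 + x) * (w s * x)`, `4 ‖y‖` from `(1
    -- + x) * z s` and `2 ‖y‖` from the average of `-z`.
    refine laurent_lexicographic_nonneg (e := |w s| + 6 * ‖y‖) ?_
    have hsmall : ∀ᶠ x in 𝓝[>] (0 : ℝ), x ∈ Set.Ioo (0 : ℝ) 1 := Ioo_mem_nhdsGT one_pos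
    refine (hd.and_eventually hsmall).mono ?_
    rintro x ⟨⟨u, hu⟩, hx0, hx1⟩
    have hz := abs_discounted_sub_laurent_le hx0 hu hKG hh hw hy
    set z : S → ℝ := fun s => u s - (G s / x + h s + w s * x) with hzdef
    have huz : ∀ s, u s = G s / x + h s + w s * x + z s := fun s => by simp only [hzdef]; ring
    have h1 := hu.1 s a
    have h2 : ∑ s', D.P s a s' * (-z s') ≤ 2 * ‖y‖ * x ^ 2 :=
      D.sum_P_mul_le s a fun s' => (neg_le_abs _).trans (hz s')
    have h3 : z s ≤ 2 * ‖y‖ * x ^ 2 := (le_abs_self _).trans (hz s)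
    have hsum : ∑ s', D.P s a s' * u s' = (∑ s', D.P s a s' * G s') / x +
        ∑ s', D.P s a s' * h s' + (∑ s', D.P s a s' * w s') * x +
        ∑ s', D.P s a s' * z s' := by
      simp only [huz, mul_add, Finset.sum_add_distrib, Finset.sum_div, Finset.sum_mul, mul_assoc,
        mul_div_assoc]
    rw [hsum, huz s] at h1
    simp only [mul_neg, Finset.sum_neg_distrib] at h2
    have h4 : (1 + x) * z s ≤ 4 * ‖y‖ * x ^ 2 := by
      have h5 := mul_le_mul_of_nonneg_left h3 (by linarith : 0 ≤ 1 + x)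
      have h6 : 0 ≤ (1 - x) * (2 * ‖y‖ * x ^ 2) :=
        mul_nonneg (by linarith) (by positivity)
      linarith
    have h7 : w s * x ^ 2 ≤ |w s| * x ^ 2 :=
      mul_le_mul_of_nonneg_right (le_abs_self _) (by positivity)
    have hxG : x * (G s / x) = G s := by field_simp
    have h8 : (G s - ∑ s', D.P s a s' * G s') / x =
        G s / x - (∑ s', D.P s a s' * G s') / x := sub_div _ _ _
    rw [h8]
    linarith
  obtain ⟨c, hc⟩ := hwc.exists_eq_const hKG fun s a => sub_nonneg.1 (hlex s a).1
  -- Constancy of `G` kills the leading coefficient for every action, which unlocks the next two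
  -- inequalities.
  have hzero : ∀ s a, G s - ∑ s', D.P s a s' * G s' = 0 := fun s a => by
    simp only [hc, sum_P_mul_const, sub_self]
  refine ⟨c, h, w, fun s a => ?_, fun s a hsa => ?_, fun s => ⟨d s, ?_, ?_⟩⟩
  · rw [← hc s]
    exact sub_nonneg.1 ((hlex s a).2 (hzero s a)).1
  · rw [← hc s] at hsa
    exact sub_nonneg.1 (((hlex s a).2 (hzero s a)).2 (sub_eq_zero.2 hsa.symm))
  · have hs := congrFun hh s
    simp only [Pi.sub_apply, chain_detPolicy_mulVec, polReward_detPolicy] at hs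
    rw [← hc s]
    linarith
  · have hs := congrFun hw s
    simp only [Pi.sub_apply, Pi.neg_apply, chain_detPolicy_mulVec] at hs
    linarith

end FiniteMDP

/-! ### Projection onto the interactions remembered by the opponent. -/

theorem biasSpan_comp_of_surjective {S T : Type*} {p : T → S} (hp : Function.Surjective p)
    (h : S → ℝ) : biasSpan (fun t => h (p t)) = biasSpan h := by
  simp only [biasSpan, hp.iSup_comp, hp.iInf_comp]

namespace RepeatedGame

open Matrix FiniteMDP

variable {A B : Type*} {m i : ℕ}

/-- A new pair shifts the older ones back, so agreement reaches one index further; this is what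
drives `eq_of_solvesBellman`. -/
theorem push_eq_push {o : A × B} {s t : History A B i} {j : ℕ}
    (hst : ∀ k : Fin i, k.val < j → s k = t k) (k : Fin i) (hk : k.val < j + 1) :
    push o s k = push o t k := by
  unfold push
  rcases Fin.eq_zero_or_eq_succ k.castSucc with h | ⟨l, hl⟩
  · rw [h, Fin.cons_zero, Fin.cons_zero]
  · rw [hl, Fin.cons_succ, Fin.cons_succ]
    refine hst l ?_
    have := congrArg Fin.val hl
    simp only [Fin.val_castSucc, Fin.val_succ] at this
    omega

theorem recent_push (hmi : m ≤ i) (o : A × B) (s : History A B i) :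
    recent hmi (push o s) = push o (recent hmi s) := by
  funext k
  simp only [recent, push]
  rcases Fin.eq_zero_or_eq_succ k.castSucc with h | ⟨l, hl⟩
  · have h' : (Fin.castLE hmi k).castSucc = 0 := Fin.ext (by simpa [Fin.ext_iff] using h)
    rw [h, h', Fin.cons_zero, Fin.cons_zero]
  · have h' : (Fin.castLE hmi k).castSucc = (Fin.castLE hmi l).succ :=
      Fin.ext (by simpa [Fin.ext_iff] using hl)
    rw [hl, h', Fin.cons_succ, Fin.cons_succ]
    rfl

theorem recent_surjective [Nonempty A] [Nonempty B] (hmi : m ≤ i) :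
    Function.Surjective (recent hmi : History A B i → History A B m) := by
  intro x
  obtain ⟨o⟩ := (inferInstance : Nonempty (A × B))
  exact ⟨fun k => if hk : k.val < m then x ⟨k, hk⟩ else o, funext fun k => by simp [recent]⟩

variable [Fintype A] [Fintype B] {U : A → B → ℝ} {ψ : History A B m → stdSimplex ℝ B}

theorem inducedMDP_sum_P_mul (hmi : m ≤ i) (f : History A B i → ℝ) (s : History A B i) (a : A) :
    ∑ s', (inducedMDP hmi U ψ).P s a s' * f s' =
      ∑ b, (ψ (recent hmi s)).1 b * f (push (a, b) s) := by
  simp only [inducedMDP, Finset.sum_mul]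
  rw [Finset.sum_comm]
  simp only [ite_mul, zero_mul, Finset.sum_ite_eq', Finset.mem_univ, if_true]

theorem inducedMDP_sum_P_mul_recent (hmi : m ≤ i) (f : History A B m → ℝ) (s : History A B i)
    (a : A) :
    ∑ s', (inducedMDP hmi U ψ).P s a s' * f (recent hmi s') =
      ∑ x, (inducedMDP le_rfl U ψ).P (recent hmi s) a x * f x := by
  rw [inducedMDP_sum_P_mul hmi fun s' => f (recent hmi s'), inducedMDP_sum_P_mul]
  simp only [recent_push]
  rfl

theorem inducedMDP_r (hmi : m ≤ i) (s : History A B i) (a : A) :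
    (inducedMDP hmi U ψ).r s a = ∑ b, (ψ (recent hmi s)).1 b * U a b := rfl

theorem inducedMDP_r_recent (hmi : m ≤ i) (s : History A B i) (a : A) :
    (inducedMDP hmi U ψ).r s a = (inducedMDP le_rfl U ψ).r (recent hmi s) a := rfl

theorem bellman_recent (hmi : m ≤ i) (f : History A B m → ℝ) (s : History A B i) :
    (inducedMDP hmi U ψ).bellman (fun s' => f (recent hmi s')) s =
      (inducedMDP le_rfl U ψ).bellman f (recent hmi s) := by
  simp only [bellman, inducedMDP_sum_P_mul_recent]
  rfl

theorem solvesBellman_recent_iff [Nonempty A] [Nonempty B] (hmi : m ≤ i) {g : ℝ}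
    {f : History A B m → ℝ} :
    (inducedMDP hmi U ψ).SolvesBellman g (fun s => f (recent hmi s)) ↔
      (inducedMDP le_rfl U ψ).SolvesBellman g f := by
  simp only [SolvesBellman, bellman_recent]
  exact ((recent_surjective hmi).forall
    (p := fun x => (inducedMDP le_rfl U ψ).bellman f x - f x = g)).symm

/-- Gives optimality against all policies of the larger process without examining its communication
structure. -/
theorem solvesNestedBellman_recent (hmi : m ≤ i) {g : ℝ} {h w : History A B m → ℝ}
    (H : (inducedMDP le_rfl U ψ).SolvesNestedBellman g h w) :
    (inducedMDP hmi U ψ).SolvesNestedBellman g (fun s => h (recent hmi s))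
      (fun s => w (recent hmi s)) where
  le s a := by
    rw [inducedMDP_sum_P_mul_recent, inducedMDP_r_recent]
    exact H.le _ a
  le_of_eq s a := by
    rw [inducedMDP_sum_P_mul_recent, inducedMDP_sum_P_mul_recent, inducedMDP_r_recent]
    exact H.le_of_eq _ a
  exists_eq s := by
    simp only [inducedMDP_sum_P_mul_recent]
    exact H.exists_eq (recent hmi s)

/-- A solution of the Bellman equation depends only on the interactions which the opponent
remembers. -/
theorem eq_of_solvesBellman (hmi : m ≤ i) {g : ℝ} {h : History A B i → ℝ}
    (H : (inducedMDP hmi U ψ).SolvesBellman g h) {s t : History A B i}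
    (hst : recent hmi s = recent hmi t) : h s = h t := by
  -- After `n` rounds `h` depends only on the `i - n` newest pairs. The bound `m ≤ i - n` keeps the
  -- opponent's mixed action determined by them.
  have key : ∀ n, m ≤ i - n → ∀ s t : History A B i,
      (∀ k : Fin i, k.val < i - n → s k = t k) → h s = h t := by
    intro n
    induction n with
    | zero => exact fun _ s t hst => congrArg h (funext fun k => hst k k.isLt)
    | succ n ih =>
      intro hn s t hst
      have hpush : ∀ o, h (push o s) = h (push o t) := fun o =>
        ih (by omega) _ _ fun k hk => push_eq_push hst k (by omega)
      have hrec : recent hmi s = recent hmi t :=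
        funext fun k => hst _ (lt_of_lt_of_le k.isLt hn)
      have hbell : (inducedMDP hmi U ψ).bellman h s = (inducedMDP hmi U ψ).bellman h t := by
        simp only [bellman, inducedMDP_sum_P_mul, inducedMDP_r, hrec, hpush]
      have h1 := H s
      have h2 := H t
      linarith
  refine key (i - m) (by omega) s t fun k hk => ?_
  exact congrFun hst ⟨k, by omega⟩

theorem exists_eq_comp_recent_of_solvesBellman [Nonempty A] [Nonempty B] (hmi : m ≤ i) {g : ℝ}
    {h : History A B i → ℝ} (H : (inducedMDP hmi U ψ).SolvesBellman g h) :
    ∃ f : History A B m → ℝ, h = fun s => f (recent hmi s) := by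
  obtain ⟨e, he⟩ := (recent_surjective (A := A) (B := B) hmi).hasRightInverse
  exact ⟨fun x => h (e x), funext fun s => eq_of_solvesBellman hmi H (he (recent hmi s)).symm⟩

theorem expect_liftPolicy (hmi : m ≤ i) (π : Policy (History A B m) A) (f : History A B m → ℝ)
    (n : ℕ) (s : History A B i) :
    (inducedMDP hmi U ψ).expect (liftPolicy hmi π) (fun s' => f (recent hmi s')) n s =
      (inducedMDP le_rfl U ψ).expect π f n (recent hmi s) := by
  refine expect_comp (fun f s => ?_) f n s
  simp only [chain_mulVec, inducedMDP_sum_P_mul_recent]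
  rfl

theorem value_liftPolicy (hmi : m ≤ i) (π : Policy (History A B m) A) (T : ℕ)
    (s : History A B i) :
    (inducedMDP hmi U ψ).value (liftPolicy hmi π) T s =
      (inducedMDP le_rfl U ψ).value π T (recent hmi s) :=
  Finset.sum_congr rfl fun t _ =>
    expect_liftPolicy hmi π ((inducedMDP le_rfl U ψ).polReward π) t s

theorem gain_liftPolicy (hmi : m ≤ i) (π : Policy (History A B m) A) (s : History A B i) :
    (inducedMDP hmi U ψ).gain (liftPolicy hmi π) s =
      (inducedMDP le_rfl U ψ).gain π (recent hmi s) := by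
  simp only [gain, value_liftPolicy]

theorem bias_liftPolicy (hmi : m ≤ i) (π : Policy (History A B m) A) (s : History A B i) :
    (inducedMDP hmi U ψ).bias (liftPolicy hmi π) s =
      (inducedMDP le_rfl U ψ).bias π (recent hmi s) := by
  have hsum : ∀ T, (inducedMDP hmi U ψ).biasSum (liftPolicy hmi π) T s =
      (inducedMDP le_rfl U ψ).biasSum π T (recent hmi s) := by
    intro T
    simp only [biasSum, gain_liftPolicy]
    exact Finset.sum_congr rfl fun t _ => expect_liftPolicy hmi π
      (fun x => (inducedMDP le_rfl U ψ).polReward π x - (inducedMDP le_rfl U ψ).gain π x) t s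
  simp only [bias, biasMean, hsum]

end RepeatedGame

/-! ### Transfer to all memory lengths. -/

theorem mainTheorem5 {A B : Type*} [Fintype A] [Nonempty A] [Fintype B] [Nonempty B]
    (U : A → B → ℝ) (hU : ∀ a b, U a b ∈ Set.Icc (0 : ℝ) 1)
    (mstar M : ℕ) (hM : mstar < M) (ψ : History A B mstar → stdSimplex ℝ B)
    (hwc : (inducedMDP le_rfl U ψ : FiniteMDP (History A B mstar) A).WeaklyCommunicating) :
    -- the gain and the bias of every policy in every class exist as limits
    (∀ (i : ℕ) (hi : mstar ≤ i), i < M → ∀ (π : Policy (History A B i) A) (s : History A B i),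
      Tendsto (fun T : ℕ => (inducedMDP hi U ψ).value π T s / T) atTop
          (𝓝 ((inducedMDP hi U ψ).gain π s)) ∧
        Tendsto (fun N : ℕ => (inducedMDP hi U ψ).biasMean π N s) atTop
          (𝓝 ((inducedMDP hi U ψ).bias π s))) ∧
    (∃ g : ℝ,
      -- the optimal gains agree
      (∀ (i : ℕ) (hi : mstar ≤ i), i < M → (inducedMDP hi U ψ).IsOptimalGain g) ∧
      -- the spans of the optimal bias functions agree
      (∃ σ : ℝ, ∀ (i : ℕ) (hi : mstar ≤ i), i < M →
        ∃ h, (inducedMDP hi U ψ).IsOptimalBias h ∧ (inducedMDP hi U ψ).SolvesBellman g h ∧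
          biasSpan h = σ) ∧
      -- the spans of all solutions of the Bellman optimality equation agree
      (∀ (i : ℕ) (hi : mstar ≤ i), i < M →
        {σ : ℝ | ∃ h, (inducedMDP hi U ψ).SolvesBellman g h ∧ biasSpan h = σ} =
          {σ : ℝ | ∃ h, (inducedMDP (le_refl mstar) U ψ).SolvesBellman g h ∧
            biasSpan h = σ})) ∧
    -- an optimal policy of the smallest class is optimal in all classes, with the same bias span
    (∀ π : Policy (History A B mstar) A, (inducedMDP le_rfl U ψ).IsOptimalPolicy π →
      ∀ (i : ℕ) (hi : mstar ≤ i), i < M →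
        (inducedMDP hi U ψ).IsOptimalPolicy (liftPolicy hi π) ∧
        biasSpan ((inducedMDP hi U ψ).bias (liftPolicy hi π)) =
          biasSpan ((inducedMDP le_rfl U ψ).bias π)) := by
  obtain ⟨g, h, w, H⟩ := hwc.exists_solvesNestedBellman
  have Hi := fun (i : ℕ) (hi : mstar ≤ i) => solvesNestedBellman_recent hi H
  refine ⟨fun i hi _ π s => ⟨tendsto_gain _ π s, tendsto_bias _ π s⟩,
    ⟨g, fun i hi _ => (Hi i hi).isOptimalGain, ⟨biasSpan h, fun i hi _ =>
      ⟨_, (Hi i hi).isOptimalBias, (Hi i hi).solvesBellman,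
        biasSpan_comp_of_surjective (recent_surjective hi) h⟩⟩, fun i hi _ => ?_⟩,
    fun π hπ i hi _ => ⟨?_, ?_⟩⟩
  · ext σ
    constructor
    · rintro ⟨k, hk, rfl⟩
      obtain ⟨f, rfl⟩ := exists_eq_comp_recent_of_solvesBellman hi hk
      exact ⟨f, (solvesBellman_recent_iff hi).1 hk,
        (biasSpan_comp_of_surjective (recent_surjective hi) f).symm⟩
    · rintro ⟨f, hf, rfl⟩
      exact ⟨_, (solvesBellman_recent_iff hi).2 hf,
        biasSpan_comp_of_surjective (recent_surjective hi) f⟩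
  · refine (Hi i hi).isOptimalPolicy_iff.2 fun s => ?_
    rw [gain_liftPolicy]
    exact H.isOptimalPolicy_iff.1 hπ _
  · simp only [funext (bias_liftPolicy hi π)]
    exact biasSpan_comp_of_surjective (recent_surjective hi) _
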